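/- Let $P\subseteq\mathbb{R}^n$ be a closed convex cone which is spanning ($P-P=\mathbb{R}^n$) and pointed ($P\cap -P=\{0\}$), and let $\Omega$ be its interior. Let $M$ be a von Neumann algebra with separable predual $M_*$. Let $\alpha=\{\alpha_x\}_{x\in P}$ be a $\sigma$-weakly measurable $E_0^P$-semigroup on $M$, that is, a family of normal unital $*$-endomorphisms of $M$ such that $\alpha_x\circ\alpha_y=\alpha_{x+y}$ for all $x,y\in P$, $\alpha_0$ is the identity map, and for all $\rho\in M_*$ and $A\in M$ the map $P\ni x\mapsto\rho(\alpha_x(A))\in\mathbb{C}$ is Borel measurable. Assume that $\alpha$ is faithful, i.e. $\bigcap_{x\in\Omega}\ker(\alpha_x)=\{0\}$. Then $\alpha$ is an $E_0^P$-semigroup on $M$, i.e. it is $\sigma$-weakly continuous: for all $\rho\in M_*$ and $A\in M$ the map $P\ni x\mapsto\rho(\alpha_x(A))$ is continuous. -/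

import Mathlib

open scoped Pointwise

noncomputable section

namespace EPSemigroup

section Predual

variable {H : Type*} [NormedAddCommGroup H] [InnerProductSpace ℂ H] [CompleteSpace H]

/-- The vector functional `A ↦ ⟪ξ, A η⟫` on a von Neumann algebra `M` acting on `H`. -/
def vectorFunctional (M : VonNeumannAlgebra H) (ξ η : H) : StrongDual ℂ M.toStarSubalgebra :=
  (innerSL ℂ ξ).comp
    ((ContinuousLinearMap.apply ℂ H η).comp
      M.toStarSubalgebra.toSubalgebra.toSubmodule.subtypeL)

/-- The predual `M_*` of a von Neumann algebra `M` acting on `H`: the norm closure, in the Banach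
dual of `M`, of the linear span of the vector functionals. It carries the norm of the dual. -/
def predual (M : VonNeumannAlgebra H) : Submodule ℂ (StrongDual ℂ M.toStarSubalgebra) :=
  (Submodule.span ℂ
    (Set.range fun p : H × H => vectorFunctional M p.1 p.2)).topologicalClosure

/-- The `σ`-weak topology of `M`: the coarsest topology for which all the functionals in the
predual are continuous. -/
abbrev sigmaWeakTopology (M : VonNeumannAlgebra H) : TopologicalSpace M.toStarSubalgebra :=
  ⨅ ρ : predual M, TopologicalSpace.induced
    (fun A : M.toStarSubalgebra => (ρ : StrongDual ℂ M.toStarSubalgebra) A) inferInstance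

/-- A (not necessarily unital) `*`-endomorphism of `M` is normal if it is continuous for the
`σ`-weak topology. -/
def IsNormal (M : VonNeumannAlgebra H)
    (f : M.toStarSubalgebra →⋆ₙₐ[ℂ] M.toStarSubalgebra) : Prop :=
  @Continuous _ _ (sigmaWeakTopology M) (sigmaWeakTopology M) f

end Predual

section Semigroup

variable {H : Type*} [NormedAddCommGroup H] [InnerProductSpace ℂ H] [CompleteSpace H]
variable {E : Type*} [NormedAddCommGroup E] [InnerProductSpace ℝ E]

/-- A semigroup of normal `*`-endomorphisms of `M` indexed by the cone `P`, with `α 0` the identity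
map and no condition on the dependence on the parameter. -/
structure IsNormalSemigroup (M : VonNeumannAlgebra H) (P : ProperCone ℝ E)
    (α : P → (M.toStarSubalgebra →⋆ₙₐ[ℂ] M.toStarSubalgebra)) : Prop where
  normal : ∀ x, IsNormal M (α x)
  comp : ∀ x y : P, ∀ A, α x (α y A) = α (x + y) A
  zero : ∀ A, α 0 A = A

/-- A `σ`-weakly (Borel) measurable `E₀^P`-semigroup on `M`. -/
structure IsMeasurableE0PSemigroup [MeasurableSpace E]
    (M : VonNeumannAlgebra H) (P : ProperCone ℝ E)
    (α : P → (M.toStarSubalgebra →⋆ₙₐ[ℂ] M.toStarSubalgebra)) : Prop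
    extends IsNormalSemigroup M P α where
  unital : ∀ x, α x 1 = 1
  measurable : ∀ ρ ∈ predual M, ∀ A, Measurable fun x : P => ρ (α x A)

/-- An `E₀^P`-semigroup on `M`, that is, a `σ`-weakly continuous one. -/
structure IsE0PSemigroup (M : VonNeumannAlgebra H) (P : ProperCone ℝ E)
    (α : P → (M.toStarSubalgebra →⋆ₙₐ[ℂ] M.toStarSubalgebra)) : Prop
    extends IsNormalSemigroup M P α where
  unital : ∀ x, α x 1 = 1
  continuous : ∀ ρ ∈ predual M, ∀ A, Continuous fun x : P => ρ (α x A)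

/-- `α` is faithful: the intersection of the kernels of `α x`, over the `x` in the interior of `P`,
is `{0}`. -/
def IsFaithful (M : VonNeumannAlgebra H) (P : ProperCone ℝ E)
    (α : P → (M.toStarSubalgebra →⋆ₙₐ[ℂ] M.toStarSubalgebra)) : Prop :=
  {A : M.toStarSubalgebra | ∀ x : P, (x : E) ∈ interior (P : Set E) → α x A = 0} = {0}

end Semigroup

end EPSemigroup

end

/-! ### Weak measurability and translation in `L¹` -/

section Measurability

open MeasureTheory TopologicalSpace

/-! Pass to the pre-adjoint semigroup on `M_*`. It consists of contractions, and norm continuity of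
its orbits gives the claim after evaluation at each `A`. Since `M` is the dual of `M_*`
(`exists_eq_apply_of_dual_predual`), the pre-adjoint orbits are weakly measurable, hence measurable
by separability and Pettis. Measurable contraction semigroups are continuous over the interior `Ω`
(`continuousAt_of_measurable_semigroup`): write `T x = T y ∘ T (x - y)` for small `y`, average over
`y`, and use continuity of translation in `L¹`. As `P + Ω ⊆ Ω`, every vector `T x v` with `x ∈ Ω`
has an orbit continuous on all of `P`. Faithfulness says by duality that these vectors are total,
and for contractions the vectors with continuous orbit form a closed subspace. -/

/-- Pettis' measurability theorem: a weakly measurable map to a separable normed space is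
Borel measurable. -/
theorem measurable_of_dual {α X 𝕜 : Type*} [RCLike 𝕜] [MeasurableSpace α] [NormedAddCommGroup X]
    [NormedSpace 𝕜 X] [SeparableSpace X] [MeasurableSpace X] [BorelSpace X] {f : α → X}
    (hf : ∀ φ : StrongDual 𝕜 X, Measurable fun a => φ (f a)) : Measurable f := by
  choose φ hφ hφd using fun i => exists_dual_vector'' 𝕜 (denseSeq X i)
  -- The functionals norming a dense sequence determine every norm: approximate `v` to within half
  -- the gap `‖v‖ - r`.
  have hnorm : ∀ (v : X) (r : ℝ), ‖v‖ ≤ r ↔ ∀ i, ‖φ i v‖ ≤ r := by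
    refine fun v r => ⟨fun h i => ?_, fun h => ?_⟩
    · exact ((φ i).le_of_opNorm_le (hφ i) v).trans (by simpa using h)
    · by_contra! hr
      obtain ⟨i, hi⟩ := (denseRange_denseSeq X).exists_dist_lt v
        (half_pos (sub_pos.2 hr))
      have h1 : ‖φ i (denseSeq X i)‖ ≤ ‖φ i v‖ + ‖φ i (v - denseSeq X i)‖ := by
        rw [map_sub]
        exact norm_le_norm_add_norm_sub _ _
      have h2 : ‖φ i (v - denseSeq X i)‖ ≤ ‖v - denseSeq X i‖ := by
        simpa using (φ i).le_of_opNorm_le (hφ i) (v - denseSeq X i)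
      have h3 : ‖v‖ ≤ ‖denseSeq X i‖ + ‖v - denseSeq X i‖ := norm_le_norm_add_norm_sub' _ _
      rw [dist_eq_norm] at hi
      rw [hφd, RCLike.norm_ofReal, abs_of_nonneg (norm_nonneg _)] at h1
      linarith [h i]
  have hsub : ∀ c, Measurable fun a => ‖f a - c‖ := by
    refine fun c => measurable_of_Iic fun r => ?_
    have : (fun a => ‖f a - c‖) ⁻¹' Set.Iic r = ⋂ i, {a | ‖φ i (f a) - φ i c‖ ≤ r} := by
      ext a
      simp [hnorm (f a - c) r]
    rw [this]
    exact .iInter fun i => measurableSet_le ((hf (φ i)).sub_const _).norm measurable_const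
  have : SecondCountableTopology X := UniformSpace.secondCountable_of_separable X
  rw [‹BorelSpace X›.measurable_eq,
    (isTopologicalBasis_of_isOpen_of_nhds (s := {B : Set X | ∃ c r, Metric.ball c r = B})
      (by rintro _ ⟨c, r, rfl⟩; exact Metric.isOpen_ball) fun v U hv hU => by
        obtain ⟨r, hr, hrU⟩ := Metric.isOpen_iff.1 hU v hv
        exact ⟨_, ⟨v, r, rfl⟩, Metric.mem_ball_self hr, hrU⟩).borel_eq_generateFrom]
  refine measurable_generateFrom ?_
  rintro _ ⟨c, r, rfl⟩
  have : f ⁻¹' Metric.ball c r = {a | ‖f a - c‖ < r} := by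
    ext a
    simp [dist_eq_norm]
  exact this ▸ measurableSet_lt (hsub c) measurable_const

/-- Translation is continuous in `L¹`. -/
theorem MeasureTheory.Integrable.exists_forall_setIntegral_norm_translate_sub_le {E X : Type*}
    [NormedAddCommGroup E] [NormedSpace ℝ E] [FiniteDimensional ℝ E] [MeasurableSpace E]
    [BorelSpace E] [NormedAddCommGroup X] [NormedSpace ℝ X] {μ : Measure E} [μ.IsAddHaarMeasure]
    {g : E → X} (hg : Integrable g μ) {K : Set E} (hK : μ K ≠ ⊤) {ε : ℝ} (hε : 0 < ε) :
    ∃ δ > 0, ∀ h : E, ‖h‖ < δ → ∫ y in K, ‖g (h - y) - g (-y)‖ ∂μ ≤ ε := by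
  obtain ⟨c, hcs, hgc, hc, hci⟩ := hg.exists_hasCompactSupport_integral_sub_le
    (show 0 < ε / 3 by positivity)
  -- The `+ 1` keeps the denominator positive when `K` is null.
  obtain ⟨δ, hδ, hcδ⟩ := Metric.uniformContinuous_iff.1 
    (hcs.uniformContinuous_of_continuous hc)
    (ε / 3 / (μ.real K + 1)) (by positivity)
  refine ⟨δ, hδ, fun h hh => ?_⟩
  have key : ∀ k : E, Integrable (fun y => ‖g (k - y) - c (k - y)‖) μ ∧
      ∫ y in K, ‖g (k - y) - c (k - y)‖ ∂μ ≤ ε / 3 := fun k => by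
    have hi : Integrable (fun y => ‖g (k - y) - c (k - y)‖) μ :=
      ((hg.sub hci).norm.comp_sub_left k)
    refine ⟨hi, (setIntegral_le_integral hi (.of_forall fun y => norm_nonneg _)).trans ?_⟩
    rw [integral_sub_left_eq_self (fun y => ‖g y - c y‖)]
    exact hgc
  have key0 := key 0
  simp only [zero_sub] at key0
  have hcK : IntegrableOn (fun _ : E => ε / 3 / (μ.real K + 1)) K μ := integrableOn_const hK
  calc ∫ y in K, ‖g (h - y) - g (-y)‖ ∂μ
      ≤ ∫ y in K, (‖g (h - y) - c (h - y)‖ + ‖g (-y) - c (-y)‖ +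
        ε / 3 / (μ.real K + 1)) ∂μ := by
        refine integral_mono ((hg.comp_sub_left h).sub hg.comp_neg).norm.integrableOn
          (((key h).1.integrableOn.add key0.1.integrableOn).add hcK) fun y => ?_
        have h1 : dist (c (h - y)) (c (-y)) < _ := hcδ (by simpa [dist_eq_norm] using hh)
        rw [dist_eq_norm] at h1
        have h2 : g (h - y) - g (-y) = (g (h - y) - c (h - y)) - (g (-y) - c (-y)) +
          (c (h - y) - c (-y)) := by abel
        calc ‖g (h - y) - g (-y)‖ ≤ _ := h2 ▸ (norm_add_le _ _)
          _ ≤ _ := by gcongr; exact norm_sub_le _ _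
    _ = (∫ y in K, ‖g (h - y) - c (h - y)‖ ∂μ) + (∫ y in K, ‖g (-y) - c (-y)‖ ∂μ) +
        μ.real K * (ε / 3 / (μ.real K + 1)) := by
        rw [integral_add (by exact (key h).1.integrableOn.add key0.1.integrableOn) hcK,
          integral_add (key h).1.integrableOn key0.1.integrableOn]
        simp
    _ ≤ ε / 3 + ε / 3 + ε / 3 := by
        gcongr
        · exact (key h).2
        · exact key0.2
        · rw [mul_div_left_comm]
          exact mul_le_of_le_one_right (by positivity)
            ((div_le_one (by positivity)).2 (by linarith))
    _ = ε := by ring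

end Measurability

/-! ### Contraction semigroups over a cone -/

section ConeSemigroup

open MeasureTheory TopologicalSpace

variable {E X : Type*} [NormedAddCommGroup E] [NormedSpace ℝ E] [FiniteDimensional ℝ E]
  [MeasurableSpace E] [BorelSpace E] [NormedAddCommGroup X] [NormedSpace ℂ X]
  {P : ProperCone ℝ E} {T : P → X →ₗ[ℂ] X}

/-- A Borel measurable semigroup of contractions, indexed by a closed convex cone, is strongly
continuous on the interior of the cone. -/
theorem continuousAt_of_measurable_semigroup [SecondCountableTopology X] [MeasurableSpace X]
    [BorelSpace X]
    (hT : ∀ x v, ‖T x v‖ ≤ ‖v‖) (hadd : ∀ x y v, T x (T y v) = T (x + y) v)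
    {v : X} (hmeas : Measurable fun x => T x v) {x : P} (hx : (x : E) ∈ interior (P : Set E)) :
    ContinuousAt (fun x => T x v) x := by
  classical
  let μ : Measure E := Measure.addHaar
  obtain ⟨δ, hδ, hδP⟩ := Metric.isOpen_iff.1 isOpen_interior (x : E) hx
  have hδP : Metric.ball (x : E) δ ⊆ P := hδP.trans interior_subset
  -- a ball near the origin inside the cone
  obtain ⟨t, ht, htx⟩ : ∃ t > 0, t * (‖(x : E)‖ + δ) < δ / 2 :=
    ⟨δ / 4 / (‖(x : E)‖ + δ), by positivity, by
      rw [div_mul_cancel₀ _ (by positivity)]; linarith⟩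
  let K : Set E := Metric.ball (t • (x : E)) (t * δ)
  have hKP : ∀ y ∈ K, y ∈ P := fun y hy => by
    have h1 : t⁻¹ • y ∈ P := hδP (by
      rw [Metric.mem_ball, dist_eq_norm] at hy ⊢
      have : t⁻¹ • y - (x : E) = t⁻¹ • (y - t • (x : E)) := by
        rw [smul_sub, inv_smul_smul₀ ht.ne']
      rw [this, norm_smul, norm_inv, Real.norm_of_nonneg ht.le, inv_mul_lt_iff₀ ht]
      exact hy)
    have h2 := P.smul_mem h1 ht.le
    rwa [smul_inv_smul₀ ht.ne'] at h2
  have hKn : ∀ y ∈ K, ‖y‖ < δ / 2 := fun y hy => by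
    rw [Metric.mem_ball, dist_eq_norm] at hy
    have := norm_le_norm_add_norm_sub' y (t • (x : E))
    rw [norm_smul, Real.norm_of_nonneg ht.le] at this
    linarith
  have hK0 : 0 < μ.real K :=
    ENNReal.toReal_pos (Metric.isOpen_ball.measure_pos μ
      ⟨_, Metric.mem_ball_self (mul_pos ht hδ)⟩).ne' measure_ball_lt_top.ne
  -- the localized orbit
  let g : E → X := (Metric.ball (x : E) δ).indicator
    fun z => if hz : z ∈ P then T ⟨z, hz⟩ v else 0
  have hgP : ∀ z (hz : z ∈ Metric.ball (x : E) δ), g z = T ⟨z, hδP hz⟩ v := fun z hz => by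
    simp only [g, Set.indicator_of_mem hz]
    exact dif_pos (hδP hz)
  have hgi : Integrable g μ := by
    have h1 : Measurable fun z => if hz : z ∈ P then T ⟨z, hz⟩ v else 0 :=
      Measurable.dite (s := {z | z ∈ P}) hmeas measurable_const P.isClosed.measurableSet
    refine (integrable_indicator_iff Metric.isOpen_ball.measurableSet).2
      (Measure.integrableOn_of_bounded measure_ball_lt_top.ne h1.aestronglyMeasurable
        (M := ‖v‖) (.of_forall fun z => ?_))
    split_ifs with hz
    · exact hT _ _
    · simp
  rw [Metric.continuousAt_iff]
  intro ε hε
  obtain ⟨η, hη, hηg⟩ := (hgi.comp_add_left (x : E)).exists_forall_setIntegral_norm_translate_sub_le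
    (K := K) measure_ball_lt_top.ne (show 0 < ε / 2 * μ.real K by positivity)
  refine ⟨min η (δ / 2), by positivity, fun {z} hz => ?_⟩
  have hzx : ‖(z : E) - x‖ < min η (δ / 2) := by rwa [← dist_eq_norm]
  -- Both `x - y` and `z - y` stay in the ball inside `P`, so the contraction `T y` can be factored
  -- out of the difference.
  have hle : ∀ y ∈ K, ‖T z v - T x v‖ ≤ ‖g (x + (((z : E) - x) - y)) - g (x + -y)‖ := by
    intro y hy
    have h1 : (x : E) + -y ∈ Metric.ball (x : E) δ := by
      simp only [Metric.mem_ball, dist_eq_norm, add_sub_cancel_left, norm_neg]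
      linarith [hKn y hy]
    have h2 : (x : E) + (((z : E) - x) - y) ∈ Metric.ball (x : E) δ := by
      simp only [Metric.mem_ball, dist_eq_norm, add_sub_cancel_left]
      linarith [hKn y hy, norm_sub_le ((z : E) - x) y, hzx.trans_le (min_le_right _ _)]
    have h3 : T x v = T ⟨y, hKP y hy⟩ (T ⟨_, hδP h1⟩ v) := by
      rw [hadd]; congr 2; ext; simp
    have h4 : T z v = T ⟨y, hKP y hy⟩ (T ⟨_, hδP h2⟩ v) := by
      rw [hadd]; congr 2; ext
      change (z : E) = y + ((x : E) + (((z : E) - x) - y))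
      abel
    rw [hgP _ h1, hgP _ h2, h3, h4, ← map_sub]
    exact hT _ _
  -- The left side of `hle` does not depend on `y`, so integrating over `K` bounds it by an `L¹`
  -- translation error.
  have hint : ‖T z v - T x v‖ * μ.real K ≤ ε / 2 * μ.real K := by
    refine le_trans ?_ (hηg ((z : E) - x) (hzx.trans_le (min_le_left _ _)))
    rw [mul_comm, ← smul_eq_mul, ← setIntegral_const]
    exact setIntegral_mono_on (integrableOn_const measure_ball_lt_top.ne)
      (((hgi.comp_add_left (x : E)).comp_sub_left _).sub
        (hgi.comp_add_left (x : E)).comp_neg).norm.integrableOn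
      Metric.isOpen_ball.measurableSet hle
  rw [dist_eq_norm]
  linarith [le_of_mul_le_mul_right hint hK0]

/-- A weakly measurable semigroup of contractions on a separable normed space, indexed by a closed
convex cone, is strongly continuous if the vectors `T x v`, with `x` in the interior of the cone,
form a total set. -/
theorem continuous_of_weaklyMeasurable_semigroup [SeparableSpace X]
    (hT : ∀ x v, ‖T x v‖ ≤ ‖v‖) (hadd : ∀ x y v, T x (T y v) = T (x + y) v)
    (hmeas : ∀ (φ : X →ₗ[ℂ] ℂ) (C : ℝ), (∀ v, ‖φ v‖ ≤ C * ‖v‖) →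
      ∀ v, Measurable fun x => φ (T x v))
    (htotal : ∀ (φ : X →ₗ[ℂ] ℂ) (C : ℝ), (∀ v, ‖φ v‖ ≤ C * ‖v‖) →
      (∀ x : P, (x : E) ∈ interior (P : Set E) → ∀ v, φ (T x v) = 0) → φ = 0) (v : X) :
    Continuous fun x => T x v := by
  have : SecondCountableTopology X := UniformSpace.secondCountable_of_separable X
  borelize X
  let S : Submodule ℂ X :=
    { carrier := {v | Continuous fun x => T x v}
      add_mem' := fun {v w} hv hw => by
        simp only [Set.mem_ofPred_eq, map_add] at hv hw ⊢
        exact hv.add hw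
      zero_mem' := by simp [continuous_const]
      smul_mem' := fun c v hv => by
        simp only [Set.mem_ofPred_eq, map_smul] at hv ⊢
        exact hv.const_smul c }
  have hS : IsClosed (S : Set X) := by
    refine isClosed_of_closure_subset fun w hw => ?_
    refine continuous_of_uniform_approx_of_continuous fun u hu => ?_
    obtain ⟨ε, hε, hεu⟩ := Metric.mem_uniformity_dist.1 hu
    obtain ⟨s, hs, hsw⟩ := Metric.mem_closure_iff.1 hw ε hε
    refine ⟨fun x => T x s, hs, fun x => hεu ?_⟩
    rw [dist_eq_norm] at hsw ⊢
    rw [← map_sub]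
    exact (hT _ _).trans_lt hsw
  have hTS : ∀ x : P, (x : E) ∈ interior (P : Set E) → ∀ v, T x v ∈ S := by
    intro x hx v
    have hm : Measurable fun x => T x v := measurable_of_dual (𝕜 := ℂ) fun φ =>
      hmeas φ ‖φ‖ φ.le_opNorm v
    refine continuous_iff_continuousAt.2 fun y => ?_
    -- The translate `y + Ω` is open and contained in `P`.
    have hxy : ((y + x : P) : E) ∈ interior (P : Set E) := by
      refine interior_maximal (s := P) (t := (fun z => (y : E) + z) '' interior (P : Set E)) ?_
        (isOpenMap_add_left (y : E) _ isOpen_interior) ⟨x, hx, rfl⟩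
      rintro _ ⟨z, hz, rfl⟩
      exact P.add_mem y.2 (interior_subset hz)
    have h := ContinuousAt.comp (f := fun y : P => y + x) (x := y)
      (continuousAt_of_measurable_semigroup hT hadd hm hxy)
      (((continuous_subtype_val.add_const (x : E)).subtype_mk _).continuousAt)
    simpa only [Function.comp_def, ← hadd] using h
  have : IsClosed (S : Set X) := hS
  -- Hahn–Banach on `X ⧸ S`: a functional vanishing on `S` but not at `v` contradicts totality.
  by_contra hv
  have hq : S.mkQ v ≠ 0 := fun h => hv ((Submodule.Quotient.mk_eq_zero S).1 h)
  obtain ⟨φ, hφ, hφv⟩ := exists_dual_vector ℂ (S.mkQ v) (norm_ne_zero_iff.2 hq)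
  have h0 := htotal ((φ : (X ⧸ S) →ₗ[ℂ] ℂ).comp S.mkQ) 1
    (fun w => (φ.le_of_opNorm_le hφ.le _).trans
      (mul_le_mul_of_nonneg_left (Submodule.Quotient.norm_mk_le S w) zero_le_one))
    fun x hx w => by
      have : S.mkQ (T x w) = 0 := (Submodule.Quotient.mk_eq_zero S).2 (hTS x hx w)
      simp [this]
  have h1 : φ (S.mkQ v) = 0 := congrArg (fun ψ => ψ v) h0
  rw [h1] at hφv
  exact hq (by simpa using hφv.symm)

end ConeSemigroup

noncomputable section

namespace EPSemigroup

/-! ### Predual duality and pre-adjoints -/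

section Preadjoint

variable {H : Type*} [NormedAddCommGroup H] [InnerProductSpace ℂ H] [CompleteSpace H]

/-- Makes `M` a C⋆-algebra, so that its `*`-endomorphisms are contractive. -/
theorem isClosed_vonNeumannAlgebra (M : VonNeumannAlgebra H) :
    IsClosed (M.toStarSubalgebra : Set (H →L[ℂ] H)) := by
  rw [VonNeumannAlgebra.coe_toStarSubalgebra, ← M.centralizer_centralizer]
  exact Set.isClosed_centralizer _

theorem norm_starAlgHom_apply_le (M : VonNeumannAlgebra H)
    (f : M.toStarSubalgebra →⋆ₙₐ[ℂ] M.toStarSubalgebra) (A : M.toStarSubalgebra) :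
    ‖f A‖ ≤ ‖A‖ := by
  let _ : CStarAlgebra M.toStarSubalgebra :=
    StarSubalgebra.cstarAlgebra _ (h_closed := isClosed_vonNeumannAlgebra M)
  exact NonUnitalStarAlgHom.norm_apply_le f A

@[simp]
theorem vectorFunctional_apply (M : VonNeumannAlgebra H) (ξ η : H) (A : M.toStarSubalgebra) :
    vectorFunctional M ξ η A = inner ℂ ξ ((A : H →L[ℂ] H) η) := rfl

theorem norm_vectorFunctional_le (M : VonNeumannAlgebra H) (ξ η : H) :
    ‖vectorFunctional M ξ η‖ ≤ ‖ξ‖ * ‖η‖ := by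
  refine ContinuousLinearMap.opNorm_le_bound _ (by positivity) fun A => ?_
  rw [vectorFunctional_apply]
  calc _ ≤ ‖ξ‖ * (‖(A : H →L[ℂ] H)‖ * ‖η‖) :=
        (norm_inner_le_norm _ _).trans (by gcongr; exact ContinuousLinearMap.le_opNorm _ _)
    _ = ‖ξ‖ * ‖η‖ * ‖A‖ := by
        rw [mul_left_comm, mul_comm]; rfl

theorem vectorFunctional_mem_predual (M : VonNeumannAlgebra H) (ξ η : H) :
    vectorFunctional M ξ η ∈ predual M :=
  Submodule.le_topologicalClosure _ (Submodule.subset_span ⟨(ξ, η), rfl⟩)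

/-- Elements of `M` are separated by the predual. -/
theorem eq_zero_of_forall_predual (M : VonNeumannAlgebra H) {A : M.toStarSubalgebra}
    (h : ∀ ρ ∈ predual M, ρ A = 0) : A = 0 := by
  ext η
  refine ext_inner_left ℂ fun ξ => ?_
  simpa using h _ (vectorFunctional_mem_predual M ξ η)

theorem vectorFunctional_add_left (M : VonNeumannAlgebra H) (ξ ξ' η : H) :
    vectorFunctional M (ξ + ξ') η = vectorFunctional M ξ η + vectorFunctional M ξ' η := by
  ext A; simp

theorem vectorFunctional_smul_left (M : VonNeumannAlgebra H) (c : ℂ) (ξ η : H) :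
    vectorFunctional M (c • ξ) η = starRingEnd ℂ c • vectorFunctional M ξ η := by
  ext A; simp [mul_comm]

theorem vectorFunctional_add_right (M : VonNeumannAlgebra H) (ξ η η' : H) :
    vectorFunctional M ξ (η + η') = vectorFunctional M ξ η + vectorFunctional M ξ η' := by
  ext A; simp

theorem vectorFunctional_smul_right (M : VonNeumannAlgebra H) (c : ℂ) (ξ η : H) :
    vectorFunctional M ξ (c • η) = c • vectorFunctional M ξ η := by
  ext A; simp

/-- Two continuous linear functionals on the closed span of a set agree if they agree on that set. -/
theorem linearMap_ext_topologicalClosure_span {V : Type*} [AddCommGroup V] [Module ℂ V]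
    [TopologicalSpace V] [IsTopologicalAddGroup V] [ContinuousConstSMul ℂ V] {S : Set V}
    {φ ψ : (Submodule.span ℂ S).topologicalClosure →ₗ[ℂ] ℂ} (hφ : Continuous φ)
    (hψ : Continuous ψ)
    (h : ∀ v (hv : v ∈ S), φ ⟨v, Submodule.le_topologicalClosure _ (Submodule.subset_span hv)⟩ =
      ψ ⟨v, Submodule.le_topologicalClosure _ (Submodule.subset_span hv)⟩) : φ = ψ := by
  have hle : Submodule.span ℂ S ≤
      (LinearMap.eqLocus φ ψ).map (Submodule.span ℂ S).topologicalClosure.subtype :=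
    Submodule.span_le.2 fun v hv => ⟨⟨v, _⟩, h v hv, rfl⟩
  ext x
  have hx : x ∈ closure {y | φ y = ψ y} := closure_subtype.2 (closure_mono hle x.2)
  exact (isClosed_eq hφ hψ).closure_subset hx

/-- The von Neumann algebra `M` is the dual of its predual. -/
theorem exists_eq_apply_of_dual_predual (M : VonNeumannAlgebra H)
    (φ : predual M →ₗ[ℂ] ℂ) {C : ℝ} (hC : ∀ ρ, ‖φ ρ‖ ≤ C * ‖ρ‖) :
    ∃ A : M.toStarSubalgebra, ∀ ρ : predual M, φ ρ = (ρ : StrongDual ℂ M.toStarSubalgebra) A := by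
  let ω : H → H → predual M := fun ξ η =>
    ⟨vectorFunctional M ξ η, vectorFunctional_mem_predual M ξ η⟩
  have hω : ∀ ξ η, ‖φ (ω ξ η)‖ ≤ |C| * ‖ξ‖ * ‖η‖ := fun ξ η => by
    rw [mul_assoc]
    refine (hC (ω ξ η)).trans ((mul_le_mul_of_nonneg_right (le_abs_self C)
      (norm_nonneg (ω ξ η))).trans ?_)
    exact mul_le_mul_of_nonneg_left (norm_vectorFunctional_le M ξ η) (abs_nonneg C)
  let L : H →ₗ⋆[ℂ] H →ₗ[ℂ] ℂ := LinearMap.mk₂'ₛₗ (starRingEnd ℂ) (RingHom.id ℂ)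
    (fun ξ η => φ (ω ξ η))
    (fun ξ ξ' η => by
      rw [← map_add]; exact congrArg φ (Subtype.ext (vectorFunctional_add_left M ξ ξ' η)))
    (fun c ξ η => by
      rw [← map_smul]; exact congrArg φ (Subtype.ext (vectorFunctional_smul_left M c ξ η)))
    (fun ξ η η' => by
      rw [← map_add]; exact congrArg φ (Subtype.ext (vectorFunctional_add_right M ξ η η')))
    (fun c ξ η => by
      rw [RingHom.id_apply, ← map_smul]
      exact congrArg φ (Subtype.ext (vectorFunctional_smul_right M c ξ η)))
  let B : H →L⋆[ℂ] H →L[ℂ] ℂ := L.mkContinuous₂ |C| hω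
  have hB : ∀ ξ η, B ξ η = φ (ω ξ η) := fun ξ η => rfl
  let A : H →L[ℂ] H := ContinuousLinearMap.adjoint (InnerProductSpace.continuousLinearMapOfBilin B)
  have hA : ∀ ξ η, inner ℂ ξ (A η) = φ (ω ξ η) := fun ξ η => by
    rw [ContinuousLinearMap.adjoint_inner_right,
      InnerProductSpace.continuousLinearMapOfBilin_apply, hB]
  -- Bicommutant: for `U` in the commutant, the vector functionals of `(U* ξ, η)` and `(ξ, U η)`
  -- coincide on `M`.
  have hAM : A ∈ M.toStarSubalgebra := by
    rw [← SetLike.mem_coe, VonNeumannAlgebra.coe_toStarSubalgebra,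
      ← M.centralizer_centralizer, Set.mem_centralizer_iff]
    intro U hU
    ext η
    refine ext_inner_left ℂ fun ξ => ?_
    rw [mul_apply_eq_comp, mul_apply_eq_comp, hA,
      ← ContinuousLinearMap.adjoint_inner_left, hA]
    refine congrArg φ (Subtype.ext ?_)
    ext C
    have := congrArg (fun D : H →L[ℂ] H => D η) (Set.mem_centralizer_iff.1 hU C C.2)
    simp only [mul_apply_eq_comp] at this
    simp only [ω, vectorFunctional_apply]
    rw [ContinuousLinearMap.adjoint_inner_left, this]
  refine ⟨⟨A, hAM⟩, ?_⟩
  let ψ : predual M →ₗ[ℂ] ℂ :=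
    ((ContinuousLinearMap.apply ℂ ℂ (⟨A, hAM⟩ : M.toStarSubalgebra)).comp
      (predual M).subtypeL).toLinearMap
  have hφ : @Continuous (predual M) ℂ instTopologicalSpaceSubtype _ φ :=
    AddMonoidHomClass.continuous_of_bound φ C hC
  have hψ : Continuous ψ := ContinuousLinearMap.continuous _
  have hφψ : φ = ψ := linearMap_ext_topologicalClosure_span hφ hψ fun v hv => by
    obtain ⟨⟨ξ, η⟩, rfl⟩ := hv
    exact (hA ξ η).symm
  exact fun ρ => congrArg (fun χ : predual M →ₗ[ℂ] ℂ => χ ρ) hφψ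

/-- A `σ`-weakly continuous functional lies in the predual. -/
theorem mem_predual_of_continuous (M : VonNeumannAlgebra H)
    (σ : StrongDual ℂ M.toStarSubalgebra)
    (hσ : @Continuous _ _ (sigmaWeakTopology M) _ σ) : σ ∈ predual M := by
  -- Continuity for the topology induced by a family of functionals means lying in their algebraic
  -- span, and `predual M` is already a subspace.
  have h := (LinearMap.mem_span_iff_continuous
    (f := fun ρ : predual M => ((ρ : StrongDual ℂ M.toStarSubalgebra) :
      M.toStarSubalgebra →ₗ[ℂ] ℂ)) (σ : M.toStarSubalgebra →ₗ[ℂ] ℂ)).2 hσ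
  have hr : Submodule.span ℂ (Set.range fun ρ : predual M =>
      ((ρ : StrongDual ℂ M.toStarSubalgebra) : M.toStarSubalgebra →ₗ[ℂ] ℂ)) ≤
      (predual M).map (ContinuousLinearMap.coeLM ℂ) := by
    rw [Submodule.span_le]
    rintro _ ⟨ρ, rfl⟩
    exact ⟨ρ, ρ.2, rfl⟩
  obtain ⟨ρ, hρ, hρσ⟩ := hr h
  rwa [← ContinuousLinearMap.coe_injective hρσ]

/-- The precomposition of a functional with a `*`-endomorphism. -/
def precomp (M : VonNeumannAlgebra H) (f : M.toStarSubalgebra →⋆ₙₐ[ℂ] M.toStarSubalgebra) :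
    StrongDual ℂ M.toStarSubalgebra →L[ℂ] StrongDual ℂ M.toStarSubalgebra :=
  ContinuousLinearMap.precomp ℂ
    ((f : M.toStarSubalgebra →ₗ[ℂ] M.toStarSubalgebra).mkContinuous 1 fun A => by
      simpa using norm_starAlgHom_apply_le M f A)

theorem precomp_mem_predual (M : VonNeumannAlgebra H)
    {f : M.toStarSubalgebra →⋆ₙₐ[ℂ] M.toStarSubalgebra} (hf : IsNormal M f)
    {ρ : StrongDual ℂ M.toStarSubalgebra} (hρ : ρ ∈ predual M) : precomp M f ρ ∈ predual M := by
  refine mem_predual_of_continuous M _ ?_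
  have h : @Continuous _ _ (sigmaWeakTopology M) _ ρ :=
    continuous_iff_le_induced.2 (iInf_le _ (⟨ρ, hρ⟩ : predual M))
  exact @Continuous.comp _ _ _ (sigmaWeakTopology M) (sigmaWeakTopology M) _ f ρ h hf

/-- The pre-adjoint of a normal `*`-endomorphism. -/
def preadjoint (M : VonNeumannAlgebra H)
    {f : M.toStarSubalgebra →⋆ₙₐ[ℂ] M.toStarSubalgebra} (hf : IsNormal M f) :
    predual M →L[ℂ] predual M :=
  (precomp M f).restrict fun _ hρ => precomp_mem_predual M hf hρ

theorem norm_preadjoint_apply_le (M : VonNeumannAlgebra H)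
    {f : M.toStarSubalgebra →⋆ₙₐ[ℂ] M.toStarSubalgebra} (hf : IsNormal M f) (ρ : predual M) :
    ‖preadjoint M hf ρ‖ ≤ ‖ρ‖ := by
  refine ContinuousLinearMap.opNorm_le_bound _ (norm_nonneg ρ) fun A => ?_
  change ‖(ρ : StrongDual ℂ M.toStarSubalgebra) (f A)‖ ≤ _
  exact (ContinuousLinearMap.le_opNorm _ _).trans
    (mul_le_mul_of_nonneg_left (norm_starAlgHom_apply_le M f A) (norm_nonneg _))

end Preadjoint

/-! ### The pre-adjoint semigroup -/

section PreadjointSemigroup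

variable {H : Type*} [NormedAddCommGroup H] [InnerProductSpace ℂ H] [CompleteSpace H]
variable {E : Type*} [NormedAddCommGroup E] [InnerProductSpace ℝ E]
  {M : VonNeumannAlgebra H} {P : ProperCone ℝ E}
  {α : P → (M.toStarSubalgebra →⋆ₙₐ[ℂ] M.toStarSubalgebra)}

/-- Pre-adjoints reverse composition, which is harmless as `P` is commutative. -/
theorem preadjoint_comp (hα : IsNormalSemigroup M P α) (x y : P) (ρ : predual M) :
    preadjoint M (hα.normal x) (preadjoint M (hα.normal y) ρ) =
      preadjoint M (hα.normal (x + y)) ρ :=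
  Subtype.ext <| ContinuousLinearMap.ext fun A => by
      change (ρ : StrongDual ℂ M.toStarSubalgebra) (α y (α x A)) =
        (ρ : StrongDual ℂ M.toStarSubalgebra) (α (x + y) A)
      rw [hα.comp, add_comm]

theorem measurable_apply_preadjoint [MeasurableSpace E]
    (hα : IsMeasurableE0PSemigroup M P α)
    (φ : predual M →ₗ[ℂ] ℂ) (C : ℝ) (hC : ∀ ρ, ‖φ ρ‖ ≤ C * ‖ρ‖) (ρ : predual M) :
    Measurable fun x => φ (preadjoint M (hα.normal x) ρ) := by
  obtain ⟨A, hA⟩ := exists_eq_apply_of_dual_predual M φ hC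
  have h : (fun x => φ (preadjoint M (hα.normal x) ρ)) =
      fun x => (ρ : StrongDual ℂ M.toStarSubalgebra) (α x A) := funext fun x => hA _
  exact h ▸ hα.measurable ρ ρ.2 A

/-- If `A` represents `φ`, the hypothesis says that every `ρ` in the predual kills `α x A`, so `A`
lies in all the kernels. -/
theorem eq_zero_of_apply_preadjoint_eq_zero (hα : IsNormalSemigroup M P α)
    (hfaithful : IsFaithful M P α)
    (φ : predual M →ₗ[ℂ] ℂ) (C : ℝ) (hC : ∀ ρ, ‖φ ρ‖ ≤ C * ‖ρ‖)
    (h0 : ∀ x : P, (x : E) ∈ interior (P : Set E) → ∀ ρ, φ (preadjoint M (hα.normal x) ρ) = 0) :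
    φ = 0 := by
  obtain ⟨A, hA⟩ := exists_eq_apply_of_dual_predual M φ hC
  have hA0 : A ∈ ({0} : Set M.toStarSubalgebra) := by
    rw [← hfaithful]
    exact fun x hx => eq_zero_of_forall_predual M fun ρ hρ =>
      (hA (preadjoint M (hα.normal x) ⟨ρ, hρ⟩)).symm.trans (h0 x hx ⟨ρ, hρ⟩)
  refine LinearMap.ext fun ρ => (hA ρ).trans ?_
  rw [Set.mem_singleton_iff.1 hA0]
  exact map_zero (ρ : StrongDual ℂ M.toStarSubalgebra)

theorem continuous_apply_of_continuous_preadjoint (hα : IsNormalSemigroup M P α)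
    {ρ : StrongDual ℂ M.toStarSubalgebra} (hρ : ρ ∈ predual M)
    (hc : Continuous fun x => preadjoint M (hα.normal x) ⟨ρ, hρ⟩) (A : M.toStarSubalgebra) :
    Continuous fun x => ρ (α x A) :=
  (ContinuousLinearMap.apply ℂ ℂ A).continuous.comp (continuous_subtype_val.comp hc)

/-- The pre-adjoint semigroup of a faithful measurable `E₀^P`-semigroup is strongly continuous. -/
theorem continuous_preadjoint [FiniteDimensional ℝ E] [MeasurableSpace E] [BorelSpace E]
    (hM : TopologicalSpace.SeparableSpace (predual M))
    (hα : IsMeasurableE0PSemigroup M P α) (hfaithful : IsFaithful M P α) (ρ : predual M) :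
    Continuous fun x => preadjoint M (hα.normal x) ρ := by
  let T : P → predual M →ₗ[ℂ] predual M := fun x => (preadjoint M (hα.normal x)).toLinearMap
  have h := @continuous_of_weaklyMeasurable_semigroup E (predual M) _ _ _ _ _
    (predual M).normedAddCommGroup (predual M).normedSpace P T hM
  have h1 := h fun x => norm_preadjoint_apply_le M (hα.normal x)
  have h2 := h1 (preadjoint_comp hα.toIsNormalSemigroup)
  have h3 := h2 (measurable_apply_preadjoint hα)
  exact h3 (eq_zero_of_apply_preadjoint_eq_zero hα.toIsNormalSemigroup hfaithful) ρ

end PreadjointSemigroup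

end EPSemigroup

end

theorem mainTheorem4 {n : ℕ} (P : ProperCone ℝ (EuclideanSpace ℝ (Fin n)))
    (hspan : (P : Set (EuclideanSpace ℝ (Fin n))) - (P : Set (EuclideanSpace ℝ (Fin n))) = Set.univ)
    (hpointed :
      (P : Set (EuclideanSpace ℝ (Fin n))) ∩ -(P : Set (EuclideanSpace ℝ (Fin n))) = {0})
    {H : Type*} [NormedAddCommGroup H] [InnerProductSpace ℂ H] [CompleteSpace H]
    (M : VonNeumannAlgebra H)
    (hM : TopologicalSpace.SeparableSpace (EPSemigroup.predual M))
    (α : P → (M.toStarSubalgebra →⋆ₙₐ[ℂ] M.toStarSubalgebra))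
    (hα : EPSemigroup.IsMeasurableE0PSemigroup M P α)
    (hfaithful : EPSemigroup.IsFaithful M P α) :
    EPSemigroup.IsE0PSemigroup M P α := by
  exact
    { toIsNormalSemigroup := hα.toIsNormalSemigroup
      unital := hα.unital
      continuous := fun ρ hρ => EPSemigroup.continuous_apply_of_continuous_preadjoint
        hα.toIsNormalSemigroup hρ (EPSemigroup.continuous_preadjoint hM hα hfaithful ⟨ρ, hρ⟩) }
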